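/- Let $N\ge 1$, $\varepsilon>0$ and $a_1,\dots,a_N\in\mathbb R\setminus\{0\}$. Let $$S=\Big\{u\in H^1(\mathbb R^N):\ \int_{\mathbb R^N}\Big(\sum_{i=1}^N a_i^2x_i^2\Big)u^2\,dx<\infty\Big\}$$ (real-valued functions, identified when equal almost everywhere) and consider the variational problem $$\mu=\inf_{u\in S,\ \int_{\mathbb R^N}u^2dx=1}\ \int_{\mathbb R^N}\Big[\varepsilon|\nabla u|^2+\frac4\varepsilon\Big(\sum_{i=1}^N a_i^2x_i^2\Big)u^2\Big]dx .$$ Then $$0<\mu=2\sum_{i=1}^N|a_i| ,$$ and the problem admits a unique positive minimizer, namely the function $$Q(x)=\Big(\prod_{i=1}^N\frac{2|a_i|}{\varepsilon\pi}\Big)^{1/4}e^{-\frac1\varepsilon\sum_{j=1}^N|a_j|x_j^2}>0,\qquad x=(x_1,\dots,x_N)\in\mathbb R^N .$$ That is, $Q\in S$, $\int_{\mathbb R^N} Q^2dx=1$, $Q$ attains $\mu$, and every $u\in S$ with $\int_{\mathbb R^N} u^2dx=1$ that attains $\mu$ and is positive almost everywhere equals $Q$ almost everywhere. -/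

import Mathlib

open MeasureTheory
open scoped ContDiff

noncomputable section

namespace LimitingProblem

/-- `G` is a weak gradient of `u` on `ℝ^N`: both are locally integrable and
`∫ u ∂ᵢφ = - ∫ Gᵢ φ` for every `i` and every test function `φ ∈ C_c^∞(ℝ^N)`. -/
structure HasWeakGradient {N : ℕ} (u : EuclideanSpace ℝ (Fin N) → ℝ)
    (G : EuclideanSpace ℝ (Fin N) → EuclideanSpace ℝ (Fin N)) : Prop where
  locallyIntegrable : LocallyIntegrable u
  locallyIntegrable_grad : LocallyIntegrable G
  integral_eq : ∀ φ : EuclideanSpace ℝ (Fin N) → ℝ, ContDiff ℝ ∞ φ → HasCompactSupport φ →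
    ∀ i : Fin N, ∫ x, u x * fderiv ℝ φ x (EuclideanSpace.single i 1) = - ∫ x, G x i * φ x

/-- Weak gradients are unique up to null sets. -/
theorem HasWeakGradient.ae_eq {N : ℕ} {u : EuclideanSpace ℝ (Fin N) → ℝ}
    {G H : EuclideanSpace ℝ (Fin N) → EuclideanSpace ℝ (Fin N)}
    (hG : HasWeakGradient u G) (hH : HasWeakGradient u H) : G =ᵐ[volume] H := by
  have hloc : ∀ {K : EuclideanSpace ℝ (Fin N) → EuclideanSpace ℝ (Fin N)},
      LocallyIntegrable K → ∀ i, LocallyIntegrable (fun x => K x i) := by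
    intro K hK i x
    obtain ⟨s, hs, h⟩ := hK x
    exact ⟨s, hs, (EuclideanSpace.proj (𝕜 := ℝ) i).integrable_comp h⟩
  have key : ∀ i, ∀ᵐ x, G x i = H x i := by
    intro i
    refine ae_eq_of_integral_contDiff_smul_eq (hloc hG.locallyIntegrable_grad i)
      (hloc hH.locallyIntegrable_grad i) fun φ hφ hc => ?_
    have h1 := hG.integral_eq φ hφ hc i
    have h2 := hH.integral_eq φ hφ hc i
    simp only [smul_eq_mul, mul_comm (φ _)]
    linarith
  filter_upwards [ae_all_iff.2 key] with x hx
  ext i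
  exact hx i

open Classical in
/-- The weak gradient `∇u` (a representative of it; `0` if `u` has no weak gradient). -/
def weakGradient {N : ℕ} (u : EuclideanSpace ℝ (Fin N) → ℝ) :
    EuclideanSpace ℝ (Fin N) → EuclideanSpace ℝ (Fin N) :=
  if h : ∃ G, HasWeakGradient u G then h.choose else 0

/-- `∇u` agrees almost everywhere with any weak gradient of `u`. -/
theorem HasWeakGradient.weakGradient_ae_eq {N : ℕ} {u : EuclideanSpace ℝ (Fin N) → ℝ}
    {G : EuclideanSpace ℝ (Fin N) → EuclideanSpace ℝ (Fin N)}
    (hG : HasWeakGradient u G) : weakGradient u =ᵐ[volume] G := by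
  have h : ∃ G, HasWeakGradient u G := ⟨G, hG⟩
  rw [weakGradient, dif_pos h]
  exact h.choose_spec.ae_eq hG

/-- `u ∈ H¹(ℝ^N)`: `u` is square integrable and has a square integrable weak gradient. -/
def MemH1 {N : ℕ} (u : EuclideanSpace ℝ (Fin N) → ℝ) : Prop :=
  MemLp u 2 ∧ ∃ G, HasWeakGradient u G ∧ MemLp G 2

/-- The weight `∑ᵢ aᵢ² xᵢ²`. -/
def weight {N : ℕ} (a : Fin N → ℝ) (x : EuclideanSpace ℝ (Fin N)) : ℝ :=
  ∑ i, a i ^ 2 * x i ^ 2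

/-- The weighted space `S = {u ∈ H¹(ℝ^N) : ∫ (∑ᵢ aᵢ² xᵢ²) u² dx < ∞}`. -/
def spaceS {N : ℕ} (a : Fin N → ℝ) : Set (EuclideanSpace ℝ (Fin N) → ℝ) :=
  {u | MemH1 u ∧ Integrable (fun x => weight a x * u x ^ 2)}

/-- The admissible functions: those `u ∈ S` with `∫ u² dx = 1`. -/
def admissible {N : ℕ} (a : Fin N → ℝ) : Set (EuclideanSpace ℝ (Fin N) → ℝ) :=
  {u | u ∈ spaceS a ∧ ∫ x, u x ^ 2 = 1}

/-- The energy `∫ [ε |∇u|² + (4/ε) (∑ᵢ aᵢ² xᵢ²) u²] dx`. -/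
def energy {N : ℕ} (ε : ℝ) (a : Fin N → ℝ) (u : EuclideanSpace ℝ (Fin N) → ℝ) : ℝ :=
  ∫ x, (ε * ‖weakGradient u x‖ ^ 2 + 4 / ε * weight a x * u x ^ 2)

/-- The value `μ` of the limiting variational problem. -/
def mu {N : ℕ} (ε : ℝ) (a : Fin N → ℝ) : ℝ :=
  sInf (energy ε a '' admissible a)

/-- `u` is a (normalized) minimizer of the limiting variational problem. -/
def IsMinimizer {N : ℕ} (ε : ℝ) (a : Fin N → ℝ) (u : EuclideanSpace ℝ (Fin N) → ℝ) : Prop :=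
  u ∈ admissible a ∧ energy ε a u = mu ε a

/-- The Gaussian `Q(x) = (∏ᵢ 2|aᵢ| / (επ))^{1/4} exp(-(1/ε) ∑ⱼ |aⱼ| xⱼ²)`. -/
def gaussianQ {N : ℕ} (ε : ℝ) (a : Fin N → ℝ) (x : EuclideanSpace ℝ (Fin N)) : ℝ :=
  (∏ i, 2 * |a i| / (ε * Real.pi)) ^ (1 / 4 : ℝ) * Real.exp (-(1 / ε) * ∑ j, |a j| * x j ^ 2)

end LimitingProblem

end

/-! This is the ground state problem of a harmonic oscillator, solved by factorization. For `u` in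
`S` with weak gradient `G`, completing the square turns the energy into `ε ∑ ‖Gᵢ + (2|aᵢ|/ε) xᵢ u‖²
+ 2 ∑ |aᵢ| ∫ u²` (`energy_eq`). The cross terms are evaluated by `∫ xᵢ u ∂ᵢu = -½ ∫ u²`
(`integral_coord_mul`), obtained by differentiating translations in `L²`, with no cutoff or density
argument.

The lower bound follows at once, and equality forces `∂ᵢu = -(2|aᵢ|/ε) xᵢ u` for every `i`. The
Gaussian solves this system; for any other solution `u/Q` has zero weak gradient, hence is constant,
and normalization and positivity make the constant 1. -/

noncomputable section

namespace LimitingProblem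

/-! ### Weak gradients: mollification, translations in `L²`, the commutator identity -/

section WeakGradient

open Filter Topology
open scoped InnerProductSpace Convolution

variable {N : ℕ} {u : EuclideanSpace ℝ (Fin N) → ℝ}
  {G : EuclideanSpace ℝ (Fin N) → EuclideanSpace ℝ (Fin N)}

/-- Mollifying commutes with weak differentiation. -/
theorem HasWeakGradient.exists_hasFDerivAt_convolution (h : HasWeakGradient u G)
    {ψ : EuclideanSpace ℝ (Fin N) → ℝ} (hψ : ContDiff ℝ ∞ ψ) (hc : HasCompactSupport ψ)
    (x : EuclideanSpace ℝ (Fin N)) :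
    ∃ D : EuclideanSpace ℝ (Fin N) →L[ℝ] ℝ,
      HasFDerivAt (fun x => ∫ s, u s * ψ (x - s)) D x ∧
      ∀ i, D (EuclideanSpace.single i 1) = ∫ s, G s i * ψ (x - s) := by
  have hψ1 : ContDiff ℝ 1 ψ := hψ.of_le (by exact_mod_cast le_top)
  have key := hc.hasFDerivAt_convolution_right (μ := volume) (ContinuousLinearMap.mul ℝ ℝ)
    h.locallyIntegrable hψ1 x
  refine ⟨_, key, fun i => ?_⟩
  rw [convolution_precompR_apply _ h.locallyIntegrable (hc.fderiv ℝ)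
    (hψ1.continuous_fderiv one_ne_zero)]
  have hd : ∀ s, fderiv ℝ (fun s => ψ (x - s)) s (EuclideanSpace.single i 1)
      = - fderiv ℝ ψ (x - s) (EuclideanSpace.single i 1) := by
    intro s
    have h1 : HasFDerivAt ψ (fderiv ℝ ψ (x - s)) (x - s) :=
      (hψ1.differentiable one_ne_zero _).hasFDerivAt
    have h2 : HasFDerivAt (fun s => x - s)
        (-ContinuousLinearMap.id ℝ (EuclideanSpace ℝ (Fin N))) s :=
      (hasFDerivAt_id s).const_sub x
    have h3 : HasFDerivAt (fun s => ψ (x - s)) ((fderiv ℝ ψ (x - s)).comp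
        (-ContinuousLinearMap.id ℝ (EuclideanSpace ℝ (Fin N)))) s := h1.comp s h2
    rw [h3.fderiv]
    simp
  have hcs : HasCompactSupport (fun s => ψ (x - s)) :=
    hc.comp_homeomorph (Homeomorph.subLeft x)
  -- The minus sign from the chain rule cancels the one in the weak derivative.
  have h3 := h.integral_eq (fun s => ψ (x - s)) (hψ.comp (contDiff_const.sub contDiff_id)) hcs i
  simp only [hd, mul_neg, integral_neg, neg_inj] at h3
  simpa [convolution] using h3

/-- A function with vanishing weak gradient is almost everywhere constant. -/
theorem HasWeakGradient.exists_ae_eq_const (h : HasWeakGradient u 0) :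
    ∃ c : ℝ, ∀ᵐ x, u x = c := by
  obtain ⟨δ, -, hδ0, hδ⟩ := exists_seq_strictAnti_tendsto' (zero_lt_one : (0 : ℝ) < 1)
  -- Almost everywhere convergence needs the ratio of outer to inner radius to stay bounded; here it
  -- is 2.
  let ρ : ℕ → ContDiffBump (0 : EuclideanSpace ℝ (Fin N)) := fun n =>
    ⟨δ n, 2 * δ n, (hδ0 n).1, by linarith [(hδ0 n).1]⟩
  have hconv := ContDiffBump.ae_convolution_tendsto_right_of_locallyIntegrable
    (φ := ρ) (l := atTop) (K := 2) (μ := volume) (by simpa [ρ] using hδ.const_mul 2)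
    (Eventually.of_forall fun n => le_rfl) h.locallyIntegrable
  have hconst : ∀ n x y, ((ρ n).normed volume ⋆[ContinuousLinearMap.lsmul ℝ ℝ, volume] u) x
      = ((ρ n).normed volume ⋆[ContinuousLinearMap.lsmul ℝ ℝ, volume] u) y := by
    intro n
    have heq : ∀ x, ((ρ n).normed volume ⋆[ContinuousLinearMap.lsmul ℝ ℝ, volume] u) x
        = ∫ s, u s * (ρ n).normed volume (x - s) := by
      intro x
      rw [convolution_eq_swap]
      simp [mul_comm]
    simp only [heq]
    have hD : ∀ x, HasFDerivAt (fun x => ∫ s, u s * (ρ n).normed volume (x - s))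
        (0 : EuclideanSpace ℝ (Fin N) →L[ℝ] ℝ) x := by
      intro x
      obtain ⟨D, hD, hD'⟩ := h.exists_hasFDerivAt_convolution
        ((ρ n).contDiff_normed (μ := volume)) (ρ n).hasCompactSupport_normed x
      have : D = 0 := by
        refine ContinuousLinearMap.coe_injective
          ((EuclideanSpace.basisFun (Fin N) ℝ).toBasis.ext fun i => ?_)
        simpa using hD' i
      exact this ▸ hD
    exact fun x y => is_const_of_fderiv_eq_zero (fun x => (hD x).differentiableAt)
      (fun x => (hD x).fderiv) x y
  obtain ⟨x₀, hx₀⟩ := hconv.exists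
  refine ⟨u x₀, hconv.mono fun x hx => ?_⟩
  refine tendsto_nhds_unique hx ?_
  simpa only [hconst _ x x₀] using hx₀

/-- Translation by `t` in the direction `e`, acting on `L²`. -/
def translate (e : EuclideanSpace ℝ (Fin N)) (t : ℝ)
    (f : Lp ℝ 2 (volume : Measure (EuclideanSpace ℝ (Fin N)))) :
    Lp ℝ 2 (volume : Measure (EuclideanSpace ℝ (Fin N))) :=
  Lp.compMeasurePreserving (fun x => x + t • e) (measurePreserving_add_right volume _) f

theorem coeFn_translate (e : EuclideanSpace ℝ (Fin N)) (t : ℝ)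
    (f : Lp ℝ 2 (volume : Measure (EuclideanSpace ℝ (Fin N)))) :
    translate e t f =ᵐ[volume] fun x => f (x + t • e) :=
  Lp.coeFn_compMeasurePreserving f _

theorem translate_toLp (e : EuclideanSpace ℝ (Fin N)) (t : ℝ) (hu : MemLp u 2) :
    translate e t hu.toLp =ᵐ[volume] fun x => u (x + t • e) :=
  (coeFn_translate e t _).trans
    ((measurePreserving_add_right volume (t • e)).quasiMeasurePreserving.ae_eq_comp hu.coeFn_toLp)

theorem continuous_translate (e : EuclideanSpace ℝ (Fin N))
    (f : Lp ℝ 2 (volume : Measure (EuclideanSpace ℝ (Fin N)))) :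
    Continuous fun t => translate e t f := by
  let g : ℝ → C(EuclideanSpace ℝ (Fin N), EuclideanSpace ℝ (Fin N)) := fun t =>
    ⟨fun x => x + t • e, by fun_prop⟩
  have hg : Continuous g := by
    refine ContinuousMap.continuous_of_continuous_uncurry _ ?_
    simp only [g, Function.uncurry_def, ContinuousMap.coe_mk]
    fun_prop
  exact (continuous_const (y := f)).compMeasurePreservingLp hg
    (fun t => measurePreserving_add_right volume (t • e)) (by simp)

theorem translate_zero (e : EuclideanSpace ℝ (Fin N))
    (f : Lp ℝ 2 (volume : Measure (EuclideanSpace ℝ (Fin N)))) : translate e 0 f = f := by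
  refine Lp.ext ((coeFn_translate e 0 f).trans ?_)
  simp

/-- Reduces identities in `L²` to scalar pairings with test functions, which mollification can
differentiate. -/
theorem eq_of_inner_test_eq {f g : Lp ℝ 2 (volume : Measure (EuclideanSpace ℝ (Fin N)))}
    (h : ∀ φ : EuclideanSpace ℝ (Fin N) → ℝ, ContDiff ℝ ∞ φ → HasCompactSupport φ →
      ∀ hφ : MemLp φ 2, ⟪hφ.toLp φ, f⟫_ℝ = ⟪hφ.toLp φ, g⟫_ℝ) : f = g := by
  refine Lp.ext (ae_eq_of_integral_contDiff_smul_eq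
    ((Lp.memLp f).locallyIntegrable (by norm_num)) ((Lp.memLp g).locallyIntegrable (by norm_num))
    fun φ hφ hc => ?_)
  have hm : MemLp φ 2 := hφ.continuous.memLp_of_hasCompactSupport hc
  have := h φ hφ hc hm
  rw [L2.inner_def, L2.inner_def] at this
  have hcongr : ∀ k : Lp ℝ 2 (volume : Measure (EuclideanSpace ℝ (Fin N))),
      ∫ x, ⟪hm.toLp φ x, k x⟫_ℝ = ∫ x, φ x • k x := fun k =>
    integral_congr_ae (hm.coeFn_toLp.mono fun x hx => by
      simp only [hx, RCLike.inner_apply, conj_trivial, smul_eq_mul, mul_comm])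
  rwa [hcongr, hcongr] at this

theorem inner_toLp_translate (e : EuclideanSpace ℝ (Fin N)) (t : ℝ) (hu : MemLp u 2)
    {w : EuclideanSpace ℝ (Fin N) → ℝ} (hw : MemLp w 2) :
    ⟪hw.toLp, translate e t hu.toLp⟫_ℝ = ∫ x, u x * w (x - t • e) := by
  rw [L2.inner_def, ← integral_add_right_eq_self (fun x => u x * w (x - t • e)) (t • e)]
  refine integral_congr_ae ?_
  filter_upwards [hw.coeFn_toLp, translate_toLp e t hu] with x hx hx'
  simp [hx, hx']

/-- The translates of an `H¹` function are differentiable in `L²`. -/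
theorem HasWeakGradient.hasDerivAt_translate (h : HasWeakGradient u G) (hu : MemLp u 2) (i : Fin N)
    (hG : MemLp (fun x => G x i) 2) :
    HasDerivAt (fun t => translate (EuclideanSpace.single i 1) t hu.toLp) hG.toLp 0 := by
  set e : EuclideanSpace ℝ (Fin N) := EuclideanSpace.single i 1 with he
  have hcont := continuous_translate e hG.toLp
  -- Fundamental theorem of calculus in `L²`. Its integrand is continuous, so differentiability at 0
  -- follows.
  have hint : ∀ t, translate e t hu.toLp
      = translate e 0 hu.toLp + ∫ r in (0 : ℝ)..t, translate e r hG.toLp := by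
    intro t
    refine eq_of_inner_test_eq fun φ hφ hc hm => ?_
    -- Reflecting `φ` makes the pairing with a translate of `u` a convolution evaluated at `r • e`.
    have hψ : ContDiff ℝ ∞ (fun x => φ (-x)) := hφ.comp contDiff_neg
    have hψc : HasCompactSupport (fun x => φ (-x)) :=
      hc.comp_homeomorph (Homeomorph.neg (EuclideanSpace ℝ (Fin N)))
    have hderiv : ∀ r : ℝ, HasDerivAt (fun r => ⟪hm.toLp, translate e r hu.toLp⟫_ℝ)
        ⟪hm.toLp, translate e r hG.toLp⟫_ℝ r := by
      intro r
      obtain ⟨D, hD, hD'⟩ := h.exists_hasFDerivAt_convolution hψ hψc (r • e)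
      have h1 : HasDerivAt (fun r : ℝ => r • e) e r := by
        simpa using (hasDerivAt_id r).smul_const e
      have h2 := hD.comp_hasDerivAt r h1
      rw [hD' i] at h2
      simpa [inner_toLp_translate, Function.comp_def] using h2
    have hc' : Continuous fun r => ⟪hm.toLp, translate e r hG.toLp⟫_ℝ :=
      continuous_const.inner hcont
    have hftc := intervalIntegral.integral_eq_sub_of_hasDerivAt (a := 0) (b := t)
      (fun r _ => hderiv r) (hc'.intervalIntegrable _ _)
    have hcomm := ((innerSL ℝ) hm.toLp).intervalIntegral_comp_comm
      (hcont.intervalIntegrable (μ := volume) 0 t)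
    simp only [innerSL_apply_apply] at hcomm
    rw [inner_add_right, ← hcomm, hftc]
    ring
  have hF := (intervalIntegral.integral_hasDerivAt_right (hcont.intervalIntegrable 0 0)
    (hcont.stronglyMeasurableAtFilter _ _) hcont.continuousAt).const_add (translate e 0 hu.toLp)
  rw [translate_zero e hG.toLp] at hF
  exact hF.congr_of_eventuallyEq (Eventually.of_forall hint)

/-- The commutator identity `∫ xᵢ u ∂ᵢu = - ½ ∫ u²`. -/
theorem HasWeakGradient.integral_coord_mul (h : HasWeakGradient u G) (hu : MemLp u 2) (i : Fin N)
    (hG : MemLp (fun x => G x i) 2) (hxu : MemLp (fun x => x i * u x) 2) :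
    2 * ∫ x, x i * u x * G x i = - ∫ x, u x ^ 2 := by
  set e : EuclideanSpace ℝ (Fin N) := EuclideanSpace.single i 1 with he
  have hU := h.hasDerivAt_translate hu i hG
  rw [← he] at hU
  have hpair : ∀ {w : EuclideanSpace ℝ (Fin N) → ℝ} (hw : MemLp w 2),
      HasDerivAt (fun t => ⟪hw.toLp, translate e t hu.toLp⟫_ℝ) ⟪hw.toLp, hG.toLp⟫_ℝ 0 := by
    intro w hw
    exact ((innerSL ℝ) hw.toLp).hasFDerivAt.comp_hasDerivAt 0 hU
  -- Shifting the variable by `t • e` replaces `xᵢ` by `xᵢ - t`. Differentiating both sides at 0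
  -- gives `A = -A - ∫ u²` for `A = ∫ xᵢ u Gᵢ`.
  have hsymm : ∀ t : ℝ, ⟪hxu.toLp, translate e t hu.toLp⟫_ℝ
      = ⟪hxu.toLp, translate e (-t) hu.toLp⟫_ℝ - t * ⟪hu.toLp, translate e (-t) hu.toLp⟫_ℝ := by
    intro t
    have hm : ∀ {w : EuclideanSpace ℝ (Fin N) → ℝ} (hw : MemLp w 2),
        ⟪hw.toLp, translate e (-t) hu.toLp⟫_ℝ = ∫ x, w x * u (x - t • e) := by
      intro w hw
      rw [L2.inner_def]
      refine integral_congr_ae ?_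
      filter_upwards [hw.coeFn_toLp, translate_toLp e (-t) hu] with x hx hx'
      simp [hx, hx', mul_comm, sub_eq_add_neg]
    have hi : ∀ {w : EuclideanSpace ℝ (Fin N) → ℝ}, MemLp w 2 →
        Integrable (fun x => w x * u (x - t • e)) := fun hw =>
      hw.integrable_mul (hu.comp_measurePreserving (measurePreserving_sub_right volume (t • e)))
    rw [inner_toLp_translate, hm, hm, ← integral_const_mul, ← integral_sub (hi hxu)
      ((hi hu).const_mul t)]
    refine integral_congr_ae (Eventually.of_forall fun x => ?_)
    simp [he]
    ring
  have hneg : ∀ {w : EuclideanSpace ℝ (Fin N) → ℝ} (hw : MemLp w 2),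
      HasDerivAt (fun t => ⟪hw.toLp, translate e (-t) hu.toLp⟫_ℝ) (-⟪hw.toLp, hG.toLp⟫_ℝ) 0 := by
    intro w hw
    have h0 := hpair hw
    rw [← neg_zero] at h0
    simpa [Function.comp_def] using h0.scomp (0 : ℝ) (hasDerivAt_neg (0 : ℝ))
  have hR := (hneg hxu).sub ((hasDerivAt_id (0 : ℝ)).mul (hneg hu))
  have hL := hpair hxu
  have huniq := hL.unique (hR.congr_of_eventuallyEq (Eventually.of_forall hsymm))
  simp only [neg_zero, translate_zero, id, one_mul, zero_mul, add_zero] at huniq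
  have h1 : ⟪hxu.toLp, hG.toLp⟫_ℝ = ∫ x, x i * u x * G x i := by
    rw [L2.inner_def]
    refine integral_congr_ae ?_
    filter_upwards [hxu.coeFn_toLp, hG.coeFn_toLp] with x hx hx'
    rw [RCLike.inner_apply, conj_trivial, hx, hx', mul_comm]
  have h2 : ⟪hu.toLp, hu.toLp⟫_ℝ = ∫ x, u x ^ 2 := by
    rw [L2.inner_def]
    refine integral_congr_ae ?_
    filter_upwards [hu.coeFn_toLp] with x hx
    simp [hx, pow_two]
  rw [h1, h2] at huniq
  linarith

end WeakGradient

/-! ### The Gaussian: moments, gradient, admissibility -/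

section Gaussian

variable {N : ℕ}

theorem integrable_prod_coord {f : Fin N → ℝ → ℝ} (hf : ∀ i, Integrable (f i)) :
    Integrable fun x : EuclideanSpace ℝ (Fin N) => ∏ i, f i (x i) :=
  (PiLp.volume_preserving_ofLp (Fin N)).integrable_comp_of_integrable
    (Integrable.fintype_prod hf)

theorem integral_prod_coord (f : Fin N → ℝ → ℝ) :
    ∫ x : EuclideanSpace ℝ (Fin N), ∏ i, f i (x i) = ∏ i, ∫ t, f i t := by
  rw [← integral_fintype_prod_volume_eq_prod]
  exact (PiLp.volume_preserving_ofLp (Fin N)).integral_comp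
    (MeasurableEquiv.toLp 2 (Fin N → ℝ)).symm.measurableEmbedding
    (fun y : Fin N → ℝ => ∏ i, f i (y i))

variable {ε : ℝ} {a : Fin N → ℝ}

theorem gaussianQ_pos (hε : 0 < ε) (ha : ∀ i, a i ≠ 0) (x : EuclideanSpace ℝ (Fin N)) :
    0 < gaussianQ ε a x :=
  mul_pos (Real.rpow_pos_of_pos (Finset.prod_pos fun i _ => by
    have := abs_pos.2 (ha i)
    positivity) _) (Real.exp_pos _)

theorem contDiff_gaussianQ : ContDiff ℝ ∞ (gaussianQ ε a) := by
  unfold gaussianQ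
  fun_prop

theorem fderiv_gaussianQ (x : EuclideanSpace ℝ (Fin N)) (i : Fin N) :
    fderiv ℝ (gaussianQ ε a) x (EuclideanSpace.single i 1)
      = -(2 / ε * |a i| * (x i * gaussianQ ε a x)) := by
  set e : EuclideanSpace ℝ (Fin N) := EuclideanSpace.single i 1 with he
  have hline : HasDerivAt (fun t : ℝ => gaussianQ ε a (x + t • e))
      (-(2 / ε * |a i| * (x i * gaussianQ ε a x))) 0 := by
    have hc : ∀ j, HasDerivAt (fun t : ℝ => (x + t • e) j) (e j) 0 := by
      intro j
      simpa using ((hasDerivAt_id (0 : ℝ)).mul_const (e j)).const_add (x j)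
    have hs : HasDerivAt (fun t : ℝ => ∑ j, |a j| * ((x + t • e) j) ^ 2)
        (∑ j, |a j| * (2 * x j * e j)) 0 := by
      refine HasDerivAt.fun_sum fun j _ => ?_
      simpa using ((hc j).pow 2).const_mul |a j|
    have hsum : ∑ j, |a j| * (2 * x j * e j) = |a i| * (2 * x i) := by
      rw [Finset.sum_eq_single i (fun j _ hj => by simp [he, hj]) (by simp)]
      simp [he]
    rw [hsum] at hs
    have := ((hs.const_mul (-(1 / ε))).exp).const_mul
      ((∏ i, 2 * |a i| / (ε * Real.pi)) ^ (1 / 4 : ℝ))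
    refine this.congr_deriv ?_
    simp only [gaussianQ, zero_smul, add_zero]
    ring
  have hd : DifferentiableAt ℝ (gaussianQ ε a) x :=
    contDiff_gaussianQ.contDiffAt.differentiableAt (by simp)
  have hd' : HasDerivAt (fun t : ℝ => gaussianQ ε a (x + t • e)) _ 0 :=
    hd.hasFDerivAt.hasLineDerivAt e
  exact hd'.unique hline

/-- The product form reduces all second moments to one-dimensional Gaussian integrals. -/
theorem gaussianQ_sq (hε : 0 < ε) (x : EuclideanSpace ℝ (Fin N)) :
    gaussianQ ε a x ^ 2 = √(∏ i, 2 * |a i| / (ε * Real.pi)) *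
      ∏ i, Real.exp (-(2 * |a i| / ε) * x i ^ 2) := by
  have hp : 0 ≤ ∏ i, 2 * |a i| / (ε * Real.pi) := Finset.prod_nonneg fun i _ => by positivity
  rw [gaussianQ, mul_pow, ← Real.exp_nat_mul, ← Real.exp_sum, ← Real.rpow_natCast,
    ← Real.rpow_mul hp, Real.sqrt_eq_rpow]
  congr 2
  · norm_num
  · simp only [Finset.mul_sum]
    refine Finset.sum_congr rfl fun i _ => ?_
    push_cast
    ring

theorem integrable_gaussianQ_sq (hε : 0 < ε) (ha : ∀ i, a i ≠ 0) :
    Integrable fun x => gaussianQ ε a x ^ 2 := by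
  simp only [gaussianQ_sq hε]
  refine (integrable_prod_coord (f := fun i t => Real.exp (-(2 * |a i| / ε) * t ^ 2))
    fun i => ?_).const_mul _
  have := abs_pos.2 (ha i)
  exact integrable_exp_neg_mul_sq (by positivity)

theorem integral_gaussianQ_sq (hε : 0 < ε) (ha : ∀ i, a i ≠ 0) :
    ∫ x, gaussianQ ε a x ^ 2 = 1 := by
  simp only [gaussianQ_sq hε]
  rw [integral_const_mul, integral_prod_coord (fun i t => Real.exp (-(2 * |a i| / ε) * t ^ 2))]
  simp only [integral_gaussian]
  rw [Real.sqrt_prod _ fun i _ => by positivity, ← Finset.prod_mul_distrib]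
  refine Finset.prod_eq_one fun i _ => ?_
  have := abs_pos.2 (ha i)
  rw [← Real.sqrt_mul (by positivity), Real.sqrt_eq_one]
  field_simp

theorem integrable_coord_mul_gaussianQ_sq (hε : 0 < ε) (ha : ∀ i, a i ≠ 0) (i : Fin N) :
    Integrable fun x : EuclideanSpace ℝ (Fin N) => (x i * gaussianQ ε a x) ^ 2 := by
  -- The factor `xᵢ²` is absorbed into the `i`-th one-dimensional factor.
  have hint := (integrable_prod_coord
    (f := fun j t => (if j = i then t ^ 2 else 1) * Real.exp (-(2 * |a j| / ε) * t ^ 2))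
    fun j => ?_).const_mul √(∏ i, 2 * |a i| / (ε * Real.pi))
  · refine hint.congr (Filter.Eventually.of_forall fun x => ?_)
    simp only [mul_pow, gaussianQ_sq hε, Finset.prod_mul_distrib, Finset.prod_ite_eq',
      Finset.mem_univ, if_true]
    ring
  · have hb : 0 < 2 * |a j| / ε := by
      have := abs_pos.2 (ha j)
      positivity
    split_ifs
    · simpa using integrable_rpow_mul_exp_neg_mul_sq hb (s := 2) (by norm_num)
    · simpa using integrable_exp_neg_mul_sq hb

theorem memLp_gaussianQ (hε : 0 < ε) (ha : ∀ i, a i ≠ 0) : MemLp (gaussianQ ε a) 2 :=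
  (memLp_two_iff_integrable_sq contDiff_gaussianQ.continuous.aestronglyMeasurable).2
    (integrable_gaussianQ_sq hε ha)

/-- The gradient of the Gaussian. -/
def gaussianQGrad (ε : ℝ) (a : Fin N → ℝ) (x : EuclideanSpace ℝ (Fin N)) :
    EuclideanSpace ℝ (Fin N) :=
  WithLp.toLp 2 fun i => -(2 / ε * |a i| * (x i * gaussianQ ε a x))

theorem continuous_gaussianQGrad : Continuous (gaussianQGrad ε a) := by
  have := (contDiff_gaussianQ (ε := ε) (a := a)).continuous
  unfold gaussianQGrad
  fun_prop

theorem memLp_gaussianQGrad (hε : 0 < ε) (ha : ∀ i, a i ≠ 0) : MemLp (gaussianQGrad ε a) 2 := by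
  rw [memLp_two_iff_integrable_sq_norm continuous_gaussianQGrad.aestronglyMeasurable]
  simp only [EuclideanSpace.norm_sq_eq, gaussianQGrad, norm_neg, Real.norm_eq_abs, sq_abs]
  refine integrable_finsetSum _ fun i _ => ?_
  simp only [mul_pow _ (_ * gaussianQ ε a _)]
  exact (integrable_coord_mul_gaussianQ_sq hε ha i).const_mul _

theorem hasWeakGradient_gaussianQ : HasWeakGradient (gaussianQ ε a) (gaussianQGrad ε a) where
  locallyIntegrable := contDiff_gaussianQ.continuous.locallyIntegrable
  locallyIntegrable_grad := continuous_gaussianQGrad.locallyIntegrable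
  integral_eq φ hφ hc i := by
    have hQ := contDiff_gaussianQ (ε := ε) (a := a)
    have hdφ : Continuous fun x => fderiv ℝ φ x (EuclideanSpace.single i 1) :=
      (hφ.continuous_fderiv (by simp)).clm_apply continuous_const
    have hdQ : Continuous fun x => fderiv ℝ (gaussianQ ε a) x (EuclideanSpace.single i 1) :=
      (hQ.continuous_fderiv (by simp)).clm_apply continuous_const
    rw [integral_mul_fderiv_eq_neg_fderiv_mul_of_integrable]
    · simp only [fderiv_gaussianQ, gaussianQGrad]
    · exact (hdQ.mul hφ.continuous).integrable_of_hasCompactSupport hc.mul_left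
    · exact (hQ.continuous.mul hdφ).integrable_of_hasCompactSupport
        ((hc.fderiv_apply (𝕜 := ℝ) _).mul_left)
    · exact (hQ.continuous.mul hφ.continuous).integrable_of_hasCompactSupport hc.mul_left
    · exact fun x _ => hQ.contDiffAt.differentiableAt (by simp)
    · exact fun x _ => hφ.contDiffAt.differentiableAt (by simp)

theorem gaussianQ_mem_admissible (hε : 0 < ε) (ha : ∀ i, a i ≠ 0) :
    gaussianQ ε a ∈ admissible a := by
  refine ⟨⟨⟨memLp_gaussianQ hε ha, _, hasWeakGradient_gaussianQ, memLp_gaussianQGrad hε ha⟩, ?_⟩,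
    integral_gaussianQ_sq hε ha⟩
  simp only [weight, Finset.sum_mul, mul_assoc, ← mul_pow]
  refine integrable_finsetSum _ fun i _ => ?_
  simp only [mul_pow (a i)]
  exact (integrable_coord_mul_gaussianQ_sq hε ha i).const_mul _

end Gaussian

/-! ### Factorization of the energy and the equality case -/

section Energy

variable {N : ℕ} {ε : ℝ} {a : Fin N → ℝ} {u : EuclideanSpace ℝ (Fin N) → ℝ}
  {G : EuclideanSpace ℝ (Fin N) → EuclideanSpace ℝ (Fin N)}

/-- Since `aᵢ ≠ 0`, the weight dominates a positive multiple of `xᵢ²`. This makes the cross terms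
`xᵢ u Gᵢ` integrable. -/
theorem memLp_coord_mul (ha : ∀ i, a i ≠ 0) (hu : u ∈ spaceS a) (i : Fin N) :
    MemLp (fun x => x i * u x) 2 := by
  have hm : AEStronglyMeasurable fun x : EuclideanSpace ℝ (Fin N) => x i * u x :=
    (by fun_prop : Continuous fun x : EuclideanSpace ℝ (Fin N) => x i).aestronglyMeasurable.mul
      hu.1.1.aestronglyMeasurable
  rw [memLp_two_iff_integrable_sq hm]
  refine (hu.2.const_mul ((a i ^ 2)⁻¹)).mono' (hm.pow 2) (Filter.Eventually.of_forall fun x => ?_)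
  have h1 : a i ^ 2 * x i ^ 2 ≤ weight a x :=
    Finset.single_le_sum (f := fun j => a j ^ 2 * x j ^ 2) (fun j _ => by positivity)
      (Finset.mem_univ i)
  have h2 : 0 < a i ^ 2 := by have := ha i; positivity
  rw [Real.norm_of_nonneg (sq_nonneg _), ← div_eq_inv_mul, le_div_iff₀ h2]
  calc (x i * u x) ^ 2 * a i ^ 2 = a i ^ 2 * x i ^ 2 * u x ^ 2 := by ring
    _ ≤ weight a x * u x ^ 2 := by gcongr

theorem memLp_coord (hG : MemLp G 2) (i : Fin N) : MemLp (fun x => G x i) 2 :=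
  (EuclideanSpace.proj (𝕜 := ℝ) i).comp_memLp' hG

/-- The annihilation operators `∂ᵢ + (2|aᵢ|/ε) xᵢ` map `S` to `L²`. -/
theorem memLp_annihilation (ha : ∀ i, a i ≠ 0) (hu : u ∈ spaceS a) (hG : MemLp G 2) (i : Fin N) :
    MemLp (fun x => G x i + 2 / ε * |a i| * (x i * u x)) 2 :=
  (memLp_coord hG i).add ((memLp_coord_mul ha hu i).const_mul _)

/-- Completing the square in the energy. -/
theorem energy_eq (hε : 0 < ε) (ha : ∀ i, a i ≠ 0) (hu : u ∈ spaceS a)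
    (h : HasWeakGradient u G) (hG : MemLp G 2) :
    energy ε a u = ε * (∑ i, ∫ x, (G x i + 2 / ε * |a i| * (x i * u x)) ^ 2)
      + 2 * (∑ i, |a i|) * ∫ x, u x ^ 2 := by
  have hsq : ∀ i, Integrable fun x => (G x i + 2 / ε * |a i| * (x i * u x)) ^ 2 := fun i =>
    (memLp_annihilation ha hu hG i).integrable_sq
  have hcross : ∀ i, Integrable fun x => x i * u x * G x i := fun i =>
    (memLp_coord_mul ha hu i).integrable_mul (memLp_coord hG i)
  have hdiff : ∀ i, Integrable fun x => ε * (G x i + 2 / ε * |a i| * (x i * u x)) ^ 2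
      - 4 * |a i| * (x i * u x * G x i) := fun i =>
    ((hsq i).const_mul ε).sub ((hcross i).const_mul _)
  have hpt : energy ε a u = ∫ x, ∑ i, (ε * (G x i + 2 / ε * |a i| * (x i * u x)) ^ 2
      - 4 * |a i| * (x i * u x * G x i)) := by
    refine integral_congr_ae ?_
    filter_upwards [h.weakGradient_ae_eq] with x hx
    rw [hx, EuclideanSpace.norm_sq_eq, weight]
    simp only [Finset.mul_sum, Finset.sum_mul, ← Finset.sum_add_distrib, Real.norm_eq_abs, sq_abs]
    refine Finset.sum_congr rfl fun i _ => ?_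
    rw [← sq_abs (a i)]
    field_simp
    ring
  rw [hpt, integral_finsetSum _ fun i _ => hdiff i]
  simp only [Finset.mul_sum, Finset.sum_mul, ← Finset.sum_add_distrib]
  refine Finset.sum_congr rfl fun i _ => ?_
  rw [integral_sub ((hsq i).const_mul ε) ((hcross i).const_mul _), integral_const_mul,
    integral_const_mul]
  -- The cross term `-4|aᵢ| ∫ xᵢ u Gᵢ` becomes `2|aᵢ| ∫ u²`.
  have := h.integral_coord_mul hu.1.1 i (memLp_coord hG i) (memLp_coord_mul ha hu i)
  linear_combination (-2 * |a i|) * this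

theorem le_energy (hε : 0 < ε) (ha : ∀ i, a i ≠ 0) (hu : u ∈ admissible a) :
    2 * ∑ i, |a i| ≤ energy ε a u := by
  obtain ⟨G, h, hG⟩ := hu.1.1.2
  rw [energy_eq hε ha hu.1 h hG, hu.2, mul_one]
  have : 0 ≤ ε * ∑ i, ∫ x, (G x i + 2 / ε * |a i| * (x i * u x)) ^ 2 :=
    mul_nonneg hε.le (Finset.sum_nonneg fun i _ => integral_nonneg fun x => sq_nonneg _)
  linarith

theorem energy_gaussianQ (hε : 0 < ε) (ha : ∀ i, a i ≠ 0) :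
    energy ε a (gaussianQ ε a) = 2 * ∑ i, |a i| := by
  have hQ := gaussianQ_mem_admissible hε ha
  rw [energy_eq hε ha hQ.1 hasWeakGradient_gaussianQ (memLp_gaussianQGrad hε ha), hQ.2]
  simp [gaussianQGrad]

theorem mu_eq (hε : 0 < ε) (ha : ∀ i, a i ≠ 0) : mu ε a = 2 * ∑ i, |a i| := by
  refine IsLeast.csInf_eq ⟨⟨_, gaussianQ_mem_admissible hε ha, energy_gaussianQ hε ha⟩, ?_⟩
  rintro _ ⟨u, hu, rfl⟩
  exact le_energy hε ha hu

/-- The weak gradient of a function attaining the lower bound solves the ground state equation. -/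
theorem weakGradient_eq_of_energy_eq (hε : 0 < ε) (ha : ∀ i, a i ≠ 0) (hu : u ∈ admissible a)
    (h : HasWeakGradient u G) (hG : MemLp G 2) (hmin : energy ε a u = 2 * ∑ i, |a i|) (i : Fin N) :
    ∀ᵐ x, G x i = -(2 / ε * |a i| * (x i * u x)) := by
  have hnn : ∀ j, 0 ≤ ∫ x, (G x j + 2 / ε * |a j| * (x j * u x)) ^ 2 := fun j =>
    integral_nonneg fun x => sq_nonneg _
  rw [energy_eq hε ha hu.1 h hG, hu.2, mul_one, add_eq_right, mul_eq_zero,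
    or_iff_right hε.ne', Finset.sum_eq_zero_iff_of_nonneg fun j _ => hnn j] at hmin
  have h0 := (integral_eq_zero_iff_of_nonneg (fun x => sq_nonneg _)
    (memLp_annihilation ha hu.1 hG i).integrable_sq).1 (hmin i (Finset.mem_univ i))
  filter_upwards [h0] with x hx
  exact eq_neg_of_add_eq_zero_left (pow_eq_zero_iff two_ne_zero |>.1 hx)

/-- Dividing a solution of the ground state equation by the Gaussian gives a function with zero
weak gradient. -/
theorem hasWeakGradient_div_gaussianQ (hε : 0 < ε) (ha : ∀ i, a i ≠ 0) (h : HasWeakGradient u G)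
    (hGu : ∀ i, ∀ᵐ x, G x i = -(2 / ε * |a i| * (x i * u x))) :
    HasWeakGradient (fun x => (gaussianQ ε a x)⁻¹ * u x) 0 where
  locallyIntegrable := by
    have hc : Continuous fun x => (gaussianQ ε a x)⁻¹ :=
      contDiff_gaussianQ.continuous.inv₀ fun x => (gaussianQ_pos hε ha x).ne'
    have := (h.locallyIntegrable.locallyIntegrableOn Set.univ).continuousOn_mul
      hc.continuousOn isOpen_univ.isLocallyClosed
    rwa [locallyIntegrableOn_univ] at this
  locallyIntegrable_grad := locallyIntegrable_zero
  integral_eq φ hφ hc i := by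
    have hQ0 : ∀ x, gaussianQ ε a x ≠ 0 := fun x => (gaussianQ_pos hε ha x).ne'
    have hQ := contDiff_gaussianQ (ε := ε) (a := a)
    have hψ : ContDiff ℝ ∞ (fun x => φ x * (gaussianQ ε a x)⁻¹) := hφ.mul (hQ.inv hQ0)
    have hψc : HasCompactSupport (fun x => φ x * (gaussianQ ε a x)⁻¹) := hc.mul_right
    -- The equation for `u` is tested with `φ/Q`; the term from differentiating `1/Q` then cancels
    -- the one from `G`.
    have hw := h.integral_eq _ hψ hψc i
    have hd : ∀ x, fderiv ℝ (fun x => φ x * (gaussianQ ε a x)⁻¹) x (EuclideanSpace.single i 1)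
        = (gaussianQ ε a x)⁻¹ * fderiv ℝ φ x (EuclideanSpace.single i 1)
          + 2 / ε * |a i| * x i * (φ x * (gaussianQ ε a x)⁻¹) := by
      intro x
      have h1 : HasFDerivAt φ (fderiv ℝ φ x) x :=
        (hφ.contDiffAt.differentiableAt (by simp)).hasFDerivAt
      have h2 : HasFDerivAt (gaussianQ ε a) (fderiv ℝ (gaussianQ ε a) x) x :=
        (hQ.contDiffAt.differentiableAt (by simp)).hasFDerivAt
      have h3 := (hasDerivAt_inv (hQ0 x)).comp_hasFDerivAt x h2
      have h4 : HasFDerivAt (fun x => φ x * (gaussianQ ε a x)⁻¹) _ x := h1.mul h3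
      rw [h4.fderiv]
      simp only [add_apply, smul_apply, smul_eq_mul, fderiv_gaussianQ]
      field_simp [hQ0 x]
      ring
    have hx : Continuous fun x : EuclideanSpace ℝ (Fin N) => 2 / ε * |a i| * x i := by fun_prop
    have hi1 : Integrable fun x => u x * ((gaussianQ ε a x)⁻¹ *
        fderiv ℝ φ x (EuclideanSpace.single i 1)) :=
      h.locallyIntegrable.integrable_smul_right_of_hasCompactSupport
        ((hQ.inv hQ0).continuous.mul ((hφ.continuous_fderiv (by simp)).clm_apply continuous_const))
        ((hc.fderiv_apply (𝕜 := ℝ) _).mul_left)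
    have hi2 : Integrable fun x => u x * (2 / ε * |a i| * x i * (φ x * (gaussianQ ε a x)⁻¹)) :=
      h.locallyIntegrable.integrable_smul_right_of_hasCompactSupport
        (hx.mul hψ.continuous) hψc.mul_left
    have hr : ∫ x, G x i * (φ x * (gaussianQ ε a x)⁻¹)
        = -∫ x, u x * (2 / ε * |a i| * x i * (φ x * (gaussianQ ε a x)⁻¹)) := by
      rw [← integral_neg]
      refine integral_congr_ae ?_
      filter_upwards [hGu i] with x hx
      rw [hx]
      ring
    simp only [hd, mul_add] at hw
    rw [integral_add hi1 hi2, hr, neg_neg, add_eq_right] at hw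
    simpa [mul_left_comm, mul_assoc] using hw

theorem ae_eq_gaussianQ_of_energy_eq (hε : 0 < ε) (ha : ∀ i, a i ≠ 0) (hu : u ∈ admissible a)
    (hmin : energy ε a u = 2 * ∑ i, |a i|) (hpos : ∀ᵐ x, 0 < u x) :
    u =ᵐ[volume] gaussianQ ε a := by
  obtain ⟨G, h, hG⟩ := hu.1.1.2
  obtain ⟨c, hc⟩ := (hasWeakGradient_div_gaussianQ hε ha h
    (weakGradient_eq_of_energy_eq hε ha hu h hG hmin)).exists_ae_eq_const
  have huc : ∀ᵐ x, u x = c * gaussianQ ε a x := hc.mono fun x hx => by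
    rw [← hx]
    field_simp [(gaussianQ_pos hε ha x).ne']
  have hc2 : c ^ 2 = 1 := by
    have h1 : ∫ x, u x ^ 2 = ∫ x, c ^ 2 * gaussianQ ε a x ^ 2 :=
      integral_congr_ae (huc.mono fun x hx => by simp only [hx, mul_pow])
    rwa [hu.2, integral_const_mul, integral_gaussianQ_sq hε ha, mul_one, eq_comm] at h1
  have hc0 : 0 < c := by
    obtain ⟨x, hx, hx'⟩ := (huc.and hpos).exists
    rw [hx] at hx'
    exact pos_of_mul_pos_left hx' (gaussianQ_pos hε ha x).le
  have hc1 : c = 1 := (pow_eq_one_iff_of_nonneg hc0.le two_ne_zero).1 hc2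
  exact huc.mono fun x hx => by rw [hx, hc1, one_mul]

end Energy

end LimitingProblem

end

open LimitingProblem in
theorem lemma2p2 (N : ℕ) (hN : 1 ≤ N) (ε : ℝ) (hε : 0 < ε)
    (a : Fin N → ℝ) (ha : ∀ i, a i ≠ 0) :
    -- the infimum is taken over a nonempty set that is bounded below
    (energy ε a '' admissible a).Nonempty ∧
    BddBelow (energy ε a '' admissible a) ∧
    0 < mu ε a ∧
    mu ε a = 2 * ∑ i, |a i| ∧
    IsMinimizer ε a (gaussianQ ε a) ∧
    (∀ x, 0 < gaussianQ ε a x) ∧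
    (∀ u : EuclideanSpace ℝ (Fin N) → ℝ,
      IsMinimizer ε a u → (∀ᵐ x, 0 < u x) → u =ᵐ[volume] gaussianQ ε a) := by
  have hmu := mu_eq hε ha
  have hQ := gaussianQ_mem_admissible hε ha
  refine ⟨⟨_, _, hQ, rfl⟩, ⟨2 * ∑ i, |a i|, ?_⟩, ?_, hmu,
    ⟨hQ, (energy_gaussianQ hε ha).trans hmu.symm⟩, gaussianQ_pos hε ha, fun u hu hpos =>
      ae_eq_gaussianQ_of_energy_eq hε ha hu.1 (hu.2.trans hmu) hpos⟩
  · rintro _ ⟨u, hu, rfl⟩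
    exact le_energy hε ha hu
  · rw [hmu]
    -- `N ≥ 1` makes the sum nonempty; for `N = 0` it would vanish.
    exact mul_pos two_pos (Finset.sum_pos (fun i _ => abs_pos.2 (ha i)) ⟨⟨0, hN⟩, Finset.mem_univ _⟩)
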